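/- Let $g(x)=-\frac{1}{2\pi}\ln|x|$ on $\mathbb{R}^2$ and let $\Delta=\{(x,x) : x\in\mathbb{R}^2\}$. Let $\omega_0,\rho_0\in L^2(\mathbb{R}^2,\mathbb{R})$ have compact support, let $K\subset\mathbb{R}^2$ be compact, and for every $N\ge 1$ let $\omega_{N,0}\in L^2(\mathbb{R}^2,\mathbb{R})$ have support in $K$ and let $q_1^0,\dots,q_N^0\in K$ (which may depend on $N$) be pairwise distinct; put $\rho_{N,0}=\frac1N\sum_{i=1}^N\delta_{q_i^0}$. Suppose that, as $N\to\infty$, $$\omega_{N,0}\longrightarrow\omega_0 \text{ in } L^2(\mathbb{R}^2),\qquad \rho_{N,0}\overset{\ast}{\rightharpoonup}\rho_0 \text{ in } \mathcal{M}(\mathbb{R}^2),$$ $$\frac{1}{N^2}\sum_{1\le i\ne j\le N} g(q_i^0-q_j^0)\longrightarrow \iint g(x-y)\,\rho_0(x)\rho_0(y)\,\mathrm{d}x\,\mathrm{d}y .$$ Here weak-$*$ convergence in the space $\mathcal{M}(\mathbb{R}^2)$ of finite signed measures is tested against continuous functions vanishing at infinity, and a function in $L^2$ with compact support is identified with the signed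 measure of which it is the density. Then $g(x-y)$ is absolutely integrable on $(\mathbb{R}^2\times\mathbb{R}^2)\setminus\Delta$ with respect to $(\rho_0+\omega_0-\rho_{N,0}-\omega_{N,0})^{\otimes 2}$ for every $N$, and $$\int_{(\mathbb{R}^2\times\mathbb{R}^2)\setminus\Delta} g(x-y)\,(\rho_0+\omega_0-\rho_{N,0}-\omega_{N,0})^{\otimes 2}(\mathrm{d}x\,\mathrm{d}y)\longrightarrow 0\qquad (N\to\infty).$$ -/

import Mathlib

open MeasureTheory Filter Topology
open scoped ZeroAtInfty

noncomputable section

/-- The Euclidean plane. -/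
abbrev Plane : Type := EuclideanSpace ℝ (Fin 2)

/-- The opposite of the Green kernel of the plane, `g(x) = -(1/2π) ln |x|`. -/
def greenKernel (x : Plane) : ℝ := -(1 / (2 * Real.pi)) * Real.log ‖x‖

/-- The (essential) support of the function `f` is contained in the closed set `K`. -/
def EssSupportSubset (f : Plane → ℝ) (K : Set Plane) : Prop :=
  ∀ᵐ x ∂(volume : Measure Plane), x ∉ K → f x = 0

/-- The (essential) support of the function `f` is compact. -/
def HasCompactEssSupport (f : Plane → ℝ) : Prop :=
  ∃ K : Set Plane, IsCompact K ∧ EssSupportSubset f K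

/-- The signed measure `f(x) dx` of an integrable function `f`. -/
def densityMeasure (f : Plane → ℝ) : SignedMeasure Plane :=
  (volume : Measure Plane).withDensityᵥ f

/-- The empirical measure `(1/N) ∑ᵢ δ_{qᵢ}`. -/
def empiricalMeasure {N : ℕ} (q : Fin N → Plane) : SignedMeasure Plane :=
  (1 / (N : ℝ)) • ∑ i : Fin N, VectorMeasure.dirac (q i) (1 : ℝ)

/-- Weak-* convergence of signed measures on the plane, in duality with the continuous functions
vanishing at infinity. -/
def WeakStarTendsto (μ : ℕ → SignedMeasure Plane) (ν : SignedMeasure Plane) : Prop :=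
  ∀ φ : C₀(Plane, ℝ),
    Tendsto (fun N => (μ N).integral (fun x => φ x) (ContinuousLinearMap.lsmul ℝ ℝ)) atTop
      (𝓝 (ν.integral (fun x => φ x) (ContinuousLinearMap.lsmul ℝ ℝ)))

/-- The tensor square `σ ⊗ σ` of a signed measure. -/
def tensorSquare (σ : SignedMeasure Plane) : SignedMeasure (Plane × Plane) :=
  σ.prod σ (ContinuousLinearMap.lsmul ℝ ℝ)

/-- The complement of the diagonal of the plane. -/
def offDiagonal : Set (Plane × Plane) := {p | p.1 ≠ p.2}

/-- `g(x - y)` is absolutely integrable off the diagonal with respect to `σ ⊗ σ`. -/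
def HasFiniteCoulombEnergy (σ : SignedMeasure Plane) : Prop :=
  (tensorSquare σ).IntegrableOn (fun p : Plane × Plane => greenKernel (p.1 - p.2)) offDiagonal

/-- The Coulomb energy of `σ` off the diagonal, `∫_{x ≠ y} g(x - y) (σ ⊗ σ)(dx dy)`. -/
def coulombEnergy (σ : SignedMeasure Plane) : ℝ :=
  ((tensorSquare σ).restrict offDiagonal).integral
    (fun p : Plane × Plane => greenKernel (p.1 - p.2)) (ContinuousLinearMap.lsmul ℝ ℝ)

end

/-!
The off-diagonal Coulomb energy is the quadratic form of a symmetric bilinear mutual energy `E`, and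
the measure at hand is `f_N dx - ρ_{N,0}` with `f_N = ρ₀ + ω₀ - ω_{N,0} → ρ₀` in `L²`. Its energy is
therefore `E(f_N, f_N) - 2 E(ρ_{N,0}, f_N) + E(ρ_{N,0}, ρ_{N,0})`. All supports lie in a fixed ball,
so `g` may be replaced by a truncation `G ∈ L²`, and by Hölder's inequality the potentials `f_N ⋆ G`
are continuous and converge uniformly to `ρ₀ ⋆ G`. Integrating them against measures of bounded mass
which converge weak-* to `ρ₀`, be it `f_N dx` or `ρ_{N,0}`, gives `E(ρ₀, ρ₀)` in the limit. The
last term tends to `E(ρ₀, ρ₀)` by assumption, and `1 - 2 + 1 = 0`.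
-/

open scoped NNReal ENNReal Convolution

section SignedMeasureDensity

variable {X Y E : Type*} [MeasurableSpace X] [MeasurableSpace Y] [NormedAddCommGroup E]
  [NormedSpace ℝ E] {μ : Measure X} {ν : Measure Y} {f : X → ℝ} {g : X → E}

theorem integrable_norm_smul_iff (hf : AEStronglyMeasurable f μ) :
    Integrable (fun x => ‖f x‖ • g x) μ ↔ Integrable (fun x => f x • g x) μ := by
  have hsign : AEStronglyMeasurable (fun x => f x / ‖f x‖) μ :=
    (hf.aemeasurable.div hf.norm.aemeasurable).aestronglyMeasurable
  have hsign_le : ∀ᵐ x ∂μ, ‖f x / ‖f x‖‖ ≤ 1 :=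
    Eventually.of_forall fun x => by simpa using div_self_le_one ‖f x‖
  have hsign_norm (x : X) : f x / ‖f x‖ * ‖f x‖ = f x :=
    div_mul_cancel_of_imp norm_eq_zero.1
  have hsign_self (x : X) : f x / ‖f x‖ * f x = ‖f x‖ := by
    rw [Real.norm_eq_abs, div_mul_eq_mul_div, ← abs_mul_abs_self, mul_self_div_self]
  refine ⟨fun h => ?_, fun h => ?_⟩
  · simpa only [Pi.smul_def', smul_smul, hsign_norm] using h.bdd_smul 1 hsign hsign_le
  · simpa only [Pi.smul_def', smul_smul, hsign_self] using h.bdd_smul 1 hsign hsign_le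

theorem integrable_withDensityᵥ_iff (hf : Integrable f μ) :
    (μ.withDensityᵥ f).Integrable g ↔ Integrable (fun x => f x • g x) μ := by
  rw [VectorMeasure.Integrable, Measure.variation_withDensityᵥ hf,
    integrable_withDensity_iff_integrable_smul₀' hf.aestronglyMeasurable.enorm
      (Eventually.of_forall fun x => enorm_lt_top), ← integrable_norm_smul_iff hf.1]
  simp only [toReal_enorm]

theorem integral_withDensityᵥ (hf : Integrable f μ) (hfg : Integrable (fun x => f x • g x) μ) :
    ∫ᵛ x, g x ∂<•(μ.withDensityᵥ f) = ∫ x, f x • g x ∂μ := by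
  have hint : Integrable g (μ.withDensity fun x => ‖f x‖ₑ) := by
    rw [← Measure.variation_withDensityᵥ hf]
    exact (integrable_withDensityᵥ_iff hf).2 hfg
  have hpos : Integrable g (μ.withDensity fun x => ENNReal.ofReal (f x)) :=
    hint.mono_measure (withDensity_mono (Eventually.of_forall fun x => Real.ofReal_le_enorm _))
  have hneg : Integrable g (μ.withDensity fun x => ENNReal.ofReal (-f x)) :=
    hint.mono_measure (withDensity_mono (Eventually.of_forall fun x =>
      (Real.ofReal_le_enorm _).trans_eq (enorm_neg _)))
  have := isFiniteMeasure_withDensity_ofReal hf.2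
  have := isFiniteMeasure_withDensity_ofReal hf.neg.2
  have hf_pos : AEMeasurable (fun x => ENNReal.ofReal (f x)) μ := hf.aemeasurable.ennreal_ofReal
  have hf_neg : AEMeasurable (fun x => ENNReal.ofReal (-f x)) μ :=
    hf.aemeasurable.neg.ennreal_ofReal
  have hlt (u : X → ℝ) : ∀ᵐ x ∂μ, ENNReal.ofReal (u x) < ∞ :=
    Eventually.of_forall fun x => ENNReal.ofReal_lt_top
  calc ∫ᵛ x, g x ∂<•(μ.withDensityᵥ f)
      = ∫ x, g x ∂(μ.withDensity fun x => ENNReal.ofReal (f x)) -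
          ∫ x, g x ∂(μ.withDensity fun x => ENNReal.ofReal (-f x)) := by
        rw [withDensityᵥ_eq_withDensity_pos_part_sub_withDensity_neg_part hf,
          VectorMeasure.integral_sub_vectorMeasure, VectorMeasure.integral_toSignedMeasure,
          VectorMeasure.integral_toSignedMeasure] <;>
        rwa [VectorMeasure.Integrable, Measure.variation_toSignedMeasure]
    _ = ∫ x, ((ENNReal.ofReal (f x)).toReal • g x - (ENNReal.ofReal (-f x)).toReal • g x) ∂μ := by
        rw [integral_withDensity_eq_integral_toReal_smul₀ hf_pos (hlt _),
          integral_withDensity_eq_integral_toReal_smul₀ hf_neg (hlt _), integral_sub]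
        · exact (integrable_withDensity_iff_integrable_smul₀' hf_pos (hlt _)).1 hpos
        · exact (integrable_withDensity_iff_integrable_smul₀' hf_neg (hlt _)).1 hneg
    _ = ∫ x, f x • g x ∂μ := by
        simp only [← sub_smul, ENNReal.toReal_ofReal', max_zero_sub_max_neg_zero_eq_self]

theorem restrict_withDensityᵥ (hf : Integrable f μ) {s : Set X}
    (hs : MeasurableSet s) : (μ.withDensityᵥ f).restrict s = (μ.restrict s).withDensityᵥ f := by
  ext t ht
  rw [VectorMeasure.restrict_apply _ hs ht, withDensityᵥ_apply hf (ht.inter hs),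
    withDensityᵥ_apply hf.integrableOn ht, Measure.restrict_restrict ht]

theorem prod_withDensityᵥ [SFinite μ] [SFinite ν] {h : Y → ℝ}
    (hf : Integrable f μ) (hh : Integrable h ν) :
    (μ.withDensityᵥ f).prod (ν.withDensityᵥ h) (ContinuousLinearMap.lsmul ℝ ℝ) =
      (μ.prod ν).withDensityᵥ (fun p => f p.1 * h p.2) := by
  refine VectorMeasure.prod_eq_of_forall_apply_prod fun s t hs ht => ?_
  rw [withDensityᵥ_apply (hf.mul_prod hh) (hs.prod ht), withDensityᵥ_apply hf hs,
    withDensityᵥ_apply hh ht, setIntegral_prod_mul]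
  rfl

end SignedMeasureDensity

section ProductBilinear

open VectorMeasure

variable {X Y E F G : Type*} [MeasurableSpace X] [MeasurableSpace Y] [NormedAddCommGroup E]
  [NormedSpace ℝ E] [NormedAddCommGroup F] [NormedSpace ℝ F] [NormedAddCommGroup G]
  [NormedSpace ℝ G] {B : E →L[ℝ] F →L[ℝ] G}

instance instIsFiniteMeasureVariation (σ : SignedMeasure X) :
    IsFiniteMeasure (VectorMeasure.variation σ) := by
  rw [← SignedMeasure.totalVariation_eq_variation]
  infer_instance

theorem vectorMeasure_sub_prod (σ σ' : VectorMeasure X E) (τ : VectorMeasure Y F)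
    [σ.HasProd τ B] [σ'.HasProd τ B] : (σ - σ').prod τ B = σ.prod τ B - σ'.prod τ B := by
  refine prod_eq_of_forall_apply_prod fun s t _ _ => ?_
  simp only [_root_.sub_apply, prod_apply, map_sub]

theorem vectorMeasure_prod_sub (σ : VectorMeasure X E) (τ τ' : VectorMeasure Y F)
    [σ.HasProd τ B] [σ.HasProd τ' B] : σ.prod (τ - τ') B = σ.prod τ B - σ.prod τ' B := by
  refine prod_eq_of_forall_apply_prod fun s t _ _ => ?_
  simp only [_root_.sub_apply, prod_apply, map_sub]

theorem vectorMeasure_map_swap_prod (σ : VectorMeasure X E) (τ : VectorMeasure Y F)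
    [σ.HasProd τ B] : (σ.prod τ B).map Prod.swap = τ.prod σ B.flip := by
  refine (prod_eq_of_forall_apply_prod fun s t hs ht => ?_).symm
  rw [map_apply _ measurable_swap (hs.prod ht), Set.preimage_swap_prod, prod_apply,
    ContinuousLinearMap.flip_apply]

end ProductBilinear

section GreenKernel

theorem lsmul_flip_real :
    (ContinuousLinearMap.lsmul ℝ ℝ : ℝ →L[ℝ] ℝ →L[ℝ] ℝ).flip = ContinuousLinearMap.lsmul ℝ ℝ := by
  ext
  simp

theorem measurable_greenKernel : Measurable greenKernel := by
  unfold greenKernel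
  fun_prop

theorem greenKernel_neg (x : Plane) : greenKernel (-x) = greenKernel x := by
  rw [greenKernel, greenKernel, norm_neg]

theorem greenKernel_sub_comm (x y : Plane) : greenKernel (x - y) = greenKernel (y - x) := by
  rw [← neg_sub, greenKernel_neg]

theorem measurableSet_offDiagonal : MeasurableSet offDiagonal :=
  (measurableSet_eq_fun measurable_fst measurable_snd).compl

end GreenKernel

section MutualEnergy

/-- `g(x - y)` is absolutely integrable off the diagonal with respect to `σ ⊗ τ`. -/
def HasFiniteMutualEnergy (σ τ : SignedMeasure Plane) : Prop :=
  (σ.prod τ (ContinuousLinearMap.lsmul ℝ ℝ)).IntegrableOn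
    (fun p : Plane × Plane => greenKernel (p.1 - p.2)) offDiagonal

/-- The mutual Coulomb energy `∫_{x ≠ y} g(x - y) (σ ⊗ τ)(dx dy)`, the bilinear form whose diagonal
is `coulombEnergy`. -/
noncomputable def mutualEnergy (σ τ : SignedMeasure Plane) : ℝ :=
  ((σ.prod τ (ContinuousLinearMap.lsmul ℝ ℝ)).restrict offDiagonal).integral
    (fun p : Plane × Plane => greenKernel (p.1 - p.2)) (ContinuousLinearMap.lsmul ℝ ℝ)

variable {σ τ : SignedMeasure Plane}

theorem prod_eq_map_swap_prod (σ τ : SignedMeasure Plane) :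
    τ.prod σ (ContinuousLinearMap.lsmul ℝ ℝ) =
      (σ.prod τ (ContinuousLinearMap.lsmul ℝ ℝ)).map MeasurableEquiv.prodComm := by
  rw [← lsmul_flip_real, ← vectorMeasure_map_swap_prod, lsmul_flip_real]
  rfl

theorem prodComm_preimage_offDiagonal :
    (MeasurableEquiv.prodComm : Plane × Plane ≃ᵐ Plane × Plane) ⁻¹' offDiagonal = offDiagonal := by
  ext p
  exact ne_comm

theorem greenKernel_sub_comp_prodComm :
    (fun p : Plane × Plane => greenKernel (p.1 - p.2)) ∘ MeasurableEquiv.prodComm =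
      fun p => greenKernel (p.1 - p.2) :=
  funext fun p => greenKernel_sub_comm p.2 p.1

theorem HasFiniteMutualEnergy.symm (h : HasFiniteMutualEnergy σ τ) :
    HasFiniteMutualEnergy τ σ := by
  rw [HasFiniteMutualEnergy, prod_eq_map_swap_prod, VectorMeasure.IntegrableOn,
    VectorMeasure.restrict_map _ MeasurableEquiv.prodComm.measurable measurableSet_offDiagonal,
    MeasurableEquiv.prodComm.measurableEmbedding.integrable_map_vectorMeasure,
    prodComm_preimage_offDiagonal, greenKernel_sub_comp_prodComm]
  exact h

theorem mutualEnergy_comm (σ τ : SignedMeasure Plane) : mutualEnergy σ τ = mutualEnergy τ σ := by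
  rw [mutualEnergy, prod_eq_map_swap_prod,
    VectorMeasure.setIntegral_map_equiv measurableSet_offDiagonal, prodComm_preimage_offDiagonal]
  exact congrArg (VectorMeasure.integral _ · _) greenKernel_sub_comp_prodComm

theorem tensorSquare_sub_restrict (σ τ : SignedMeasure Plane) :
    (tensorSquare (σ - τ)).restrict offDiagonal =
      (tensorSquare σ).restrict offDiagonal
        - (τ.prod σ (ContinuousLinearMap.lsmul ℝ ℝ)).restrict offDiagonal
        - ((σ.prod τ (ContinuousLinearMap.lsmul ℝ ℝ)).restrict offDiagonal
          - (tensorSquare τ).restrict offDiagonal) := by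
  simp only [tensorSquare, vectorMeasure_prod_sub, vectorMeasure_sub_prod,
    VectorMeasure.restrict_sub]

theorem HasFiniteCoulombEnergy.sub (hσ : HasFiniteCoulombEnergy σ)
    (hστ : HasFiniteMutualEnergy σ τ) (hτ : HasFiniteCoulombEnergy τ) :
    HasFiniteCoulombEnergy (σ - τ) := by
  rw [HasFiniteCoulombEnergy, VectorMeasure.IntegrableOn, tensorSquare_sub_restrict]
  exact (hσ.sub_vectorMeasure hστ.symm).sub_vectorMeasure (hστ.sub_vectorMeasure hτ)

theorem coulombEnergy_sub (hσ : HasFiniteCoulombEnergy σ) (hστ : HasFiniteMutualEnergy σ τ)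
    (hτ : HasFiniteCoulombEnergy τ) :
    coulombEnergy (σ - τ) = coulombEnergy σ - 2 * mutualEnergy σ τ + coulombEnergy τ := by
  rw [coulombEnergy, tensorSquare_sub_restrict,
    VectorMeasure.integral_sub_vectorMeasure (hσ.sub_vectorMeasure hστ.symm)
      (hστ.sub_vectorMeasure hτ),
    VectorMeasure.integral_sub_vectorMeasure hσ hστ.symm,
    VectorMeasure.integral_sub_vectorMeasure hστ hτ]
  change coulombEnergy σ - mutualEnergy τ σ - (mutualEnergy σ τ - coulombEnergy τ) = _
  rw [mutualEnergy_comm τ σ]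
  ring

variable {μ ν : Measure Plane} [SFinite μ] [SFinite ν] {f h : Plane → ℝ}

theorem hasFiniteMutualEnergy_withDensityᵥ_iff (hf : Integrable f μ) (hh : Integrable h ν) :
    HasFiniteMutualEnergy (μ.withDensityᵥ f) (ν.withDensityᵥ h) ↔
      IntegrableOn (fun p => f p.1 * h p.2 * greenKernel (p.1 - p.2)) offDiagonal (μ.prod ν) := by
  rw [HasFiniteMutualEnergy, prod_withDensityᵥ hf hh, VectorMeasure.IntegrableOn,
    restrict_withDensityᵥ (hf.mul_prod hh) measurableSet_offDiagonal,
    integrable_withDensityᵥ_iff (hf.mul_prod hh).integrableOn]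
  rfl

theorem mutualEnergy_withDensityᵥ (hf : Integrable f μ) (hh : Integrable h ν)
    (hfin : HasFiniteMutualEnergy (μ.withDensityᵥ f) (ν.withDensityᵥ h)) :
    mutualEnergy (μ.withDensityᵥ f) (ν.withDensityᵥ h) =
      ∫ p in offDiagonal, f p.1 * h p.2 * greenKernel (p.1 - p.2) ∂(μ.prod ν) := by
  rw [mutualEnergy, prod_withDensityᵥ hf hh,
    restrict_withDensityᵥ (hf.mul_prod hh) measurableSet_offDiagonal, ← lsmul_flip_real,
    integral_withDensityᵥ (hf.mul_prod hh).integrableOn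
      ((hasFiniteMutualEnergy_withDensityᵥ_iff hf hh).1 hfin)]
  rfl

end MutualEnergy

section ConvolutionLp

variable {G E E' F : Type*} [AddCommGroup G] [MeasurableSpace G] [NormedAddCommGroup E]
  [NormedSpace ℝ E] [NormedAddCommGroup E'] [NormedSpace ℝ E'] [NormedAddCommGroup F]
  [NormedSpace ℝ F] {L : E →L[ℝ] E' →L[ℝ] F} {μ ν : Measure G} {p q : ℝ≥0∞} {f : G → E} {g : G → E'}

theorem sub_convolution_apply {f' : G → E} {x : G} (hf : ConvolutionExistsAt f g x L μ)
    (hf' : ConvolutionExistsAt f' g x L μ) :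
    ((f - f') ⋆[L, μ] g) x = (f ⋆[L, μ] g) x - (f' ⋆[L, μ] g) x := by
  simp only [convolution, Pi.sub_apply, map_sub, _root_.sub_apply]
  exact integral_sub hf hf'

variable [MeasurableAdd₂ G] [MeasurableNeg G] [μ.IsAddLeftInvariant] [μ.IsNegInvariant]
  [ENNReal.HolderConjugate p q]

theorem convolutionExists_of_memLp (hf : MemLp f p μ) (hg : MemLp g q μ) :
    ConvolutionExists f g L μ := by
  intro x
  have hgx : MemLp (fun t => g (x - t)) q μ :=
    hg.comp_measurePreserving (Measure.measurePreserving_sub_left μ x)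
  exact memLp_one_iff_integrable.1 <| hf.of_bilin (L · ·) ‖L‖₊ hgx
    (L.aestronglyMeasurable_comp₂ hf.1 hgx.1) (Eventually.of_forall fun _ => L.le_opNorm₂ _ _)

theorem integral_norm_convolution_integrand_le (hf : MemLp f p μ) (hg : MemLp g q μ) (x : G) :
    ∫ t, ‖L (f t) (g (x - t))‖ ∂μ ≤ ‖L‖ * (eLpNorm f p μ).toReal * (eLpNorm g q μ).toReal := by
  have hpres := Measure.measurePreserving_sub_left μ x
  have hgx : MemLp (fun t => g (x - t)) q μ := hg.comp_measurePreserving hpres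
  have holder : eLpNorm (fun t => L (f t) (g (x - t))) 1 μ ≤
      ‖L‖₊ * eLpNorm f p μ * eLpNorm (g ∘ (x - ·)) q μ :=
    eLpNorm_le_eLpNorm_mul_eLpNorm'_of_norm hf.1 hgx.1 (L · ·) ‖L‖₊
      (Eventually.of_forall fun _ => L.le_opNorm₂ _ _)
  rw [eLpNorm_one_eq_lintegral_enorm, eLpNorm_comp_measurePreserving hg.1 hpres] at holder
  have hfin : ‖L‖₊ * eLpNorm f p μ * eLpNorm g q μ ≠ ∞ :=
    ENNReal.mul_ne_top (ENNReal.mul_ne_top ENNReal.coe_ne_top hf.2.ne) hg.2.ne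
  rw [integral_norm_eq_lintegral_enorm (L.aestronglyMeasurable_comp₂ hf.1 hgx.1)]
  simpa only [ENNReal.toReal_mul, ENNReal.coe_toReal, coe_nnnorm] using
    ENNReal.toReal_mono hfin holder

theorem norm_convolution_le (hf : MemLp f p μ) (hg : MemLp g q μ) (x : G) :
    ‖(f ⋆[L, μ] g) x‖ ≤ ‖L‖ * (eLpNorm f p μ).toReal * (eLpNorm g q μ).toReal :=
  (norm_integral_le_integral_norm _).trans (integral_norm_convolution_integrand_le hf hg x)

theorem tendstoUniformly_convolution {ι : Type*} {l : Filter ι} {u : ι → G → E}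
    (hu : ∀ i, MemLp (u i) p μ) (hf : MemLp f p μ) (hg : MemLp g q μ)
    (hlim : Tendsto (fun i => eLpNorm (u i - f) p μ) l (𝓝 0)) :
    TendstoUniformly (fun i => u i ⋆[L, μ] g) (f ⋆[L, μ] g) l := by
  have hbound : Tendsto (fun i => ‖L‖ * (eLpNorm (u i - f) p μ).toReal * (eLpNorm g q μ).toReal)
      l (𝓝 0) := by
    simpa using (((ENNReal.tendsto_toReal ENNReal.zero_ne_top).comp hlim).const_mul ‖L‖).mul_const
      (eLpNorm g q μ).toReal
  refine Metric.tendstoUniformly_iff.2 fun ε hε => ?_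
  filter_upwards [hbound.eventually_lt_const hε] with i hi x
  rw [dist_comm, dist_eq_norm, ← sub_convolution_apply (convolutionExists_of_memLp (hu i) hg x)
    (convolutionExists_of_memLp hf hg x)]
  exact (norm_convolution_le ((hu i).sub hf) hg x).trans_lt hi

theorem continuous_convolution_of_memLp [TopologicalSpace G] [IsTopologicalAddGroup G]
    [BorelSpace G] [NormalSpace G] [WeaklyLocallyCompactSpace G] [μ.Regular]
    (hp : p ≠ ∞) (hf : MemLp f p μ) (hg : MemLp g q μ) : Continuous (f ⋆[L, μ] g) := by
  have happrox (n : ℕ) := hf.exists_hasCompactSupport_eLpNorm_sub_le hp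
    (ε := (n + 1 : ℝ≥0∞)⁻¹) (ENNReal.inv_ne_zero.2 (by finiteness))
  choose u hu_supp hu_le hu_cont hu using happrox
  have hlim : Tendsto (fun n => eLpNorm (u n - f) p μ) atTop (𝓝 0) := by
    refine tendsto_of_tendsto_of_tendsto_of_le_of_le tendsto_const_nhds
      ((tendsto_add_atTop_iff_nat 1).2 ENNReal.tendsto_inv_nat_nhds_zero)
      (fun _ => zero_le) fun n => ?_
    simpa [eLpNorm_sub_comm (u n) f] using hu_le n
  refine (tendstoUniformly_convolution hu hf hg hlim).continuous (Frequently.of_forall fun n => ?_)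
  exact (hu_supp n).continuous_convolution_left L (hu_cont n)
    (hg.locallyIntegrable (ENNReal.HolderConjugate.one_le q p))

theorem integrable_smul_convolution_integrand [SFinite μ] [SFinite ν] {h : G → ℝ}
    (hh : Integrable h ν) (hf : MemLp f p μ) (hg : MemLp g q μ) (hgm : StronglyMeasurable g) :
    Integrable (fun z : G × G => h z.1 • L (f z.2) (g (z.1 - z.2))) (ν.prod μ) := by
  have hmeas : AEStronglyMeasurable (fun z : G × G => h z.1 • L (f z.2) (g (z.1 - z.2)))
      (ν.prod μ) :=
    hh.1.comp_fst.smul (L.aestronglyMeasurable_comp₂ hf.1.comp_snd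
      (hgm.comp_measurable measurable_sub).aestronglyMeasurable)
  rw [integrable_prod_iff hmeas]
  refine ⟨Eventually.of_forall fun x => (convolutionExists_of_memLp hf hg x).smul (h x), ?_⟩
  refine (hh.norm.mul_const (‖L‖ * (eLpNorm f p μ).toReal * (eLpNorm g q μ).toReal)).mono'
    hmeas.norm.integral_prod_right' (Eventually.of_forall fun x => ?_)
  simp only [norm_smul, integral_const_mul, norm_mul, norm_norm]
  gcongr
  exact (Real.norm_of_nonneg (integral_nonneg fun _ => norm_nonneg _)).trans_le
    (integral_norm_convolution_integrand_le hf hg x)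

theorem integral_prod_smul_convolution_integrand [SFinite μ] [SFinite ν] {h : G → ℝ}
    (hh : Integrable h ν) (hf : MemLp f p μ) (hg : MemLp g q μ) (hgm : StronglyMeasurable g) :
    ∫ z : G × G, h z.1 • L (f z.2) (g (z.1 - z.2)) ∂(ν.prod μ) =
      ∫ x, h x • (f ⋆[L, μ] g) x ∂ν := by
  rw [integral_prod _ (integrable_smul_convolution_integrand hh hf hg hgm)]
  simp only [integral_smul]
  rfl

end ConvolutionLp

section LogKernel

theorem integrableOn_pow_mul_log_sq (n : ℕ) (R : ℝ) :
    IntegrableOn (fun r : ℝ => r ^ n * Real.log r ^ 2) (Set.Ioc 0 R) := by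
  -- `log² r = 16 (r^{1/4} log r^{1/4})² r^{-1/2}`, where `s ↦ s log s` is continuous up to `0`.
  have hcont : Continuous fun r : ℝ =>
      r ^ n * (16 * (r ^ (1 / 4 : ℝ) * Real.log (r ^ (1 / 4 : ℝ))) ^ 2) :=
    (continuous_pow n).mul <| ((Real.continuous_mul_log.comp
      (Real.continuous_rpow_const (by norm_num))).pow 2).const_mul 16
  have hrpow : IntervalIntegrable (fun r : ℝ => r ^ (-(1 / 2) : ℝ)) volume 0 R :=
    intervalIntegral.intervalIntegrable_rpow' (by norm_num)
  refine (hrpow.continuousOn_mul hcont.continuousOn).1.congr_fun (fun r hr => ?_) measurableSet_Ioc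
  have hcancel : (r ^ (1 / 4 : ℝ)) ^ 2 * r ^ (-(1 / 2) : ℝ) = 1 := by
    rw [← Real.rpow_mul_natCast hr.1.le, ← Real.rpow_add hr.1]
    norm_num
  simp only [Real.log_rpow hr.1]
  linear_combination (r ^ n * Real.log r ^ 2) * hcancel

variable {E : Type*} [NormedAddCommGroup E] [NormedSpace ℝ E] [Nontrivial E]
  [FiniteDimensional ℝ E] [MeasurableSpace E] [BorelSpace E] (μ : Measure E) [μ.IsAddHaarMeasure]

theorem memLp_two_indicator_closedBall_log_norm (R : ℝ) :
    MemLp ((Metric.closedBall (0 : E) R).indicator fun x => Real.log ‖x‖) 2 μ := by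
  have hsq (x : E) : (Metric.closedBall (0 : E) R).indicator (fun x => Real.log ‖x‖) x ^ 2 =
      (Set.Iic R).indicator (fun r => Real.log r ^ 2) ‖x‖ := by
    by_cases hx : ‖x‖ ≤ R <;> simp [hx]
  rw [memLp_two_iff_integrable_sq ((by fun_prop : Measurable fun x : E => Real.log ‖x‖).indicator
    measurableSet_closedBall).aestronglyMeasurable]
  simp only [hsq]
  rw [integrable_fun_norm_addHaar]
  have hmul : (fun r : ℝ => r ^ (Module.finrank ℝ E - 1) •
      (Set.Iic R).indicator (fun r => Real.log r ^ 2) r) =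
        (Set.Iic R).indicator fun r => r ^ (Module.finrank ℝ E - 1) * Real.log r ^ 2 :=
    funext fun r => (Set.indicator_smul_apply (Set.Iic R) (· ^ _) _ r).symm
  rw [hmul, integrableOn_indicator_iff measurableSet_Iic, Set.inter_comm, Set.Ioi_inter_Iic]
  exact integrableOn_pow_mul_log_sq _ R

/-- The Green kernel cut off outside the closed ball of radius `R`, which makes it square
integrable. -/
noncomputable def truncatedGreenKernel (R : ℝ) : Plane → ℝ :=
  (Metric.closedBall 0 R).indicator greenKernel

theorem measurable_truncatedGreenKernel (R : ℝ) : Measurable (truncatedGreenKernel R) :=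
  measurable_greenKernel.indicator measurableSet_closedBall

theorem memLp_truncatedGreenKernel (R : ℝ) : MemLp (truncatedGreenKernel R) 2 := by
  have hlog := (memLp_two_indicator_closedBall_log_norm (volume : Measure Plane) R).const_mul
    (-(1 / (2 * Real.pi)))
  simp only [← Set.indicator_const_mul] at hlog
  exact hlog

theorem truncatedGreenKernel_sub {R : ℝ} {x y : Plane} (hx : x ∈ Metric.closedBall 0 R)
    (hy : y ∈ Metric.closedBall 0 R) :
    truncatedGreenKernel (2 * R) (x - y) = greenKernel (x - y) := by
  rw [mem_closedBall_zero_iff] at hx hy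
  refine Set.indicator_of_mem ?_ _
  rw [mem_closedBall_zero_iff, two_mul]
  exact norm_sub_le_of_le hx hy

end LogKernel

section EmpiricalMeasure

variable {X Y ι κ : Type*} [MeasurableSpace X] [MeasurableSpace Y] [Fintype ι] [Fintype κ]

/-- The empirical measure of a finite family of points, as a positive measure; it is the zero
measure for the empty family. -/
noncomputable def empiricalPosMeasure (q : ι → X) : Measure X :=
  (Fintype.card ι : ℝ≥0)⁻¹ • ∑ i, Measure.dirac (q i)

instance instIsFiniteMeasureEmpiricalPosMeasure (q : ι → X) :
    IsFiniteMeasure (empiricalPosMeasure q) := by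
  unfold empiricalPosMeasure
  infer_instance

theorem empiricalPosMeasure_prod (q : ι → X) (r : κ → Y) :
    (empiricalPosMeasure q).prod (empiricalPosMeasure r) =
      empiricalPosMeasure (Prod.map q r) := by
  refine Measure.prod_eq fun s t hs ht => ?_
  simp only [empiricalPosMeasure, Measure.smul_apply, Measure.finsetSum_apply,
    Measure.dirac_apply' _ hs, Measure.dirac_apply' _ ht, Measure.dirac_apply' _ (hs.prod ht),
    Fintype.card_prod, Fintype.sum_prod_type, Set.indicator_prod_one, Prod.map_apply,
    ENNReal.smul_def, smul_eq_mul, Nat.cast_mul, mul_inv, ENNReal.coe_mul, ← Finset.mul_sum,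
    ← Finset.sum_mul]
  ring

variable [MeasurableSingletonClass X]

theorem ae_empiricalPosMeasure {q : ι → X} {p : X → Prop} (hp : ∀ i, p (q i)) :
    ∀ᵐ x ∂(empiricalPosMeasure q), p x := by
  refine Measure.ae_smul_measure ?_ _
  rw [← Measure.sum_fintype, Measure.ae_sum_iff]
  intro i
  rw [ae_dirac_eq]
  exact hp i

theorem integrable_empiricalPosMeasure {E : Type*} [NormedAddCommGroup E] (q : ι → X)
    (u : X → E) : Integrable u (empiricalPosMeasure q) :=
  (integrable_finsetSum_measure.2 fun _ _ => integrable_dirac enorm_lt_top).smul_measure_nnreal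

theorem integral_empiricalPosMeasure (q : ι → X) (u : X → ℝ) :
    ∫ x, u x ∂(empiricalPosMeasure q) = (Fintype.card ι : ℝ)⁻¹ * ∑ i, u (q i) := by
  rw [empiricalPosMeasure, integral_smul_nnreal_measure,
    integral_finsetSum_measure fun _ _ => integrable_dirac enorm_lt_top]
  simp only [integral_dirac, NNReal.smul_def, NNReal.coe_inv, NNReal.coe_natCast, smul_eq_mul]

theorem empiricalMeasure_eq_withDensityᵥ {N : ℕ} (q : Fin N → Plane) :
    empiricalMeasure q = (empiricalPosMeasure q).withDensityᵥ 1 := by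
  ext s hs
  rw [withDensityᵥ_apply (integrable_empiricalPosMeasure q 1) hs, ← integral_indicator hs,
    integral_empiricalPosMeasure, empiricalMeasure, _root_.smul_apply, _root_.sum_apply]
  simp only [one_div, smul_eq_mul, Fintype.card_fin]
  congr 2 with i
  by_cases h : q i ∈ s <;> simp [h, hs]

theorem hasFiniteCoulombEnergy_empiricalMeasure {N : ℕ} (q : Fin N → Plane) :
    HasFiniteCoulombEnergy (empiricalMeasure q) := by
  have hone := integrable_empiricalPosMeasure q (1 : Plane → ℝ)
  rw [empiricalMeasure_eq_withDensityᵥ]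
  refine (hasFiniteMutualEnergy_withDensityᵥ_iff hone hone).2 ?_
  rw [empiricalPosMeasure_prod]
  exact (integrable_empiricalPosMeasure _ _).integrableOn

theorem coulombEnergy_empiricalMeasure {N : ℕ} {q : Fin N → Plane} (hq : Function.Injective q) :
    coulombEnergy (empiricalMeasure q) =
      1 / (N : ℝ) ^ 2 *
        ∑ p ∈ (Finset.univ : Finset (Fin N)).offDiag, greenKernel (q p.1 - q p.2) := by
  classical
  have hone := integrable_empiricalPosMeasure q (1 : Plane → ℝ)
  have hfin := hasFiniteCoulombEnergy_empiricalMeasure q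
  have hoffDiag : (Finset.univ : Finset (Fin N)).offDiag =
      Finset.univ.filter fun p : Fin N × Fin N => Prod.map q q p ∈ offDiagonal := by
    ext p
    simp [offDiagonal, hq.ne_iff]
  rw [empiricalMeasure_eq_withDensityᵥ] at hfin ⊢
  calc coulombEnergy ((empiricalPosMeasure q).withDensityᵥ 1)
      = ∫ p in offDiagonal, 1 * 1 * greenKernel (p.1 - p.2)
          ∂((empiricalPosMeasure q).prod (empiricalPosMeasure q)) :=
        mutualEnergy_withDensityᵥ hone hone hfin
    _ = _ := by
        rw [← integral_indicator measurableSet_offDiagonal, empiricalPosMeasure_prod,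
          integral_empiricalPosMeasure, hoffDiag, Finset.sum_filter]
        simp [Set.indicator_apply, sq]

end EmpiricalMeasure

section EssentialSupport

variable {X E : Type*} [MeasurableSpace X] [NormedAddCommGroup E] {μ : Measure X} {f : X → E}
  {s : Set X} {p : ℝ≥0∞}

theorem eLpNorm_one_le_of_ae_eq_zero_off (hp : 1 ≤ p) (hf : AEStronglyMeasurable f μ)
    (hs : MeasurableSet s) (hfs : ∀ᵐ x ∂μ, x ∉ s → f x = 0) :
    eLpNorm f 1 μ ≤ eLpNorm f p μ * μ s ^ (1 - 1 / p.toReal) := by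
  have hind : s.indicator f =ᵐ[μ] f := by
    filter_upwards [hfs] with x hx
    by_cases hxs : x ∈ s
    · exact Set.indicator_of_mem hxs f
    · rw [Set.indicator_of_notMem hxs, hx hxs]
  have hmono := eLpNorm_le_eLpNorm_mul_rpow_measure_univ hp (hf.restrict (s := s))
  rwa [← eLpNorm_indicator_eq_eLpNorm_restrict hs, ← eLpNorm_indicator_eq_eLpNorm_restrict hs,
    eLpNorm_congr_ae hind, eLpNorm_congr_ae hind, Measure.restrict_apply_univ,
    ENNReal.toReal_one, div_one] at hmono

theorem integrable_of_memLp_of_ae_eq_zero_off (hp : 1 ≤ p) (hf : MemLp f p μ)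
    (hs : MeasurableSet s) (hμs : μ s ≠ ∞) (hfs : ∀ᵐ x ∂μ, x ∉ s → f x = 0) :
    Integrable f μ := by
  have hexp : 0 ≤ 1 - 1 / p.toReal := by
    simpa using ENNReal.toReal_mono ENNReal.one_ne_top (ENNReal.inv_le_one.2 hp)
  exact memLp_one_iff_integrable.1 ⟨hf.1,
    (eLpNorm_one_le_of_ae_eq_zero_off hp hf.1 hs hfs).trans_lt <|
      ENNReal.mul_lt_top hf.2 (ENNReal.rpow_lt_top_of_nonneg hexp hμs)⟩

theorem EssSupportSubset.mono {f : Plane → ℝ} {K L : Set Plane} (hf : EssSupportSubset f K)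
    (hKL : K ⊆ L) : EssSupportSubset f L := by
  filter_upwards [hf] with x hx hxL
  exact hx (mt (@hKL x) hxL)

theorem EssSupportSubset.add {f g : Plane → ℝ} {K : Set Plane} (hf : EssSupportSubset f K)
    (hg : EssSupportSubset g K) : EssSupportSubset (f + g) K := by
  filter_upwards [hf, hg] with x hfx hgx hxK
  rw [Pi.add_apply, hfx hxK, hgx hxK, add_zero]

theorem EssSupportSubset.sub {f g : Plane → ℝ} {K : Set Plane} (hf : EssSupportSubset f K)
    (hg : EssSupportSubset g K) : EssSupportSubset (f - g) K := by
  filter_upwards [hf, hg] with x hfx hgx hxK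
  rw [Pi.sub_apply, hfx hxK, hgx hxK, sub_zero]

theorem EssSupportSubset.integrable {f : Plane → ℝ} {R : ℝ}
    (hf : EssSupportSubset f (Metric.closedBall 0 R)) (hf₂ : MemLp f 2) : Integrable f :=
  integrable_of_memLp_of_ae_eq_zero_off one_le_two hf₂ measurableSet_closedBall
    measure_closedBall_lt_top.ne hf

end EssentialSupport

section Potential

theorem restrict_offDiagonal_prod {μ ν : Measure Plane} [SFinite ν] [NullSingletonClass ν] :
    (μ.prod ν).restrict offDiagonal = μ.prod ν := by
  refine Measure.restrict_eq_self_of_ae_mem ?_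
  refine (Measure.ae_prod_iff_ae_ae (p := (· ∈ offDiagonal)) measurableSet_offDiagonal).2 ?_
  exact Eventually.of_forall fun x => (Measure.ae_ne ν x).mono fun y => Ne.symm

variable {R : ℝ} {f h : Plane → ℝ} {ν : Measure Plane}

theorem ae_mul_truncatedGreenKernel_eq (hf : EssSupportSubset f (Metric.closedBall 0 R))
    (hhR : ∀ᵐ x ∂ν, x ∉ Metric.closedBall 0 R → h x = 0) :
    (fun p : Plane × Plane => h p.1 * (f p.2 * truncatedGreenKernel (2 * R) (p.1 - p.2)))
      =ᵐ[ν.prod volume] fun p => h p.1 * f p.2 * greenKernel (p.1 - p.2) := by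
  filter_upwards [Measure.quasiMeasurePreserving_fst.ae hhR,
    Measure.quasiMeasurePreserving_snd.ae hf] with p hhp hfp
  by_cases h₁ : p.1 ∈ Metric.closedBall 0 R
  · by_cases h₂ : p.2 ∈ Metric.closedBall 0 R
    · rw [truncatedGreenKernel_sub h₁ h₂, mul_assoc]
    · simp only [hfp h₂, zero_mul, mul_zero]
  · simp only [hhp h₁, zero_mul]

variable [SFinite ν]

theorem hasFiniteMutualEnergy_densityMeasure (hh : Integrable h ν)
    (hhR : ∀ᵐ x ∂ν, x ∉ Metric.closedBall 0 R → h x = 0) (hf : MemLp f 2)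
    (hfR : EssSupportSubset f (Metric.closedBall 0 R)) :
    HasFiniteMutualEnergy (ν.withDensityᵥ h) (densityMeasure f) := by
  refine (hasFiniteMutualEnergy_withDensityᵥ_iff hh (hfR.integrable hf)).2 ?_
  rw [IntegrableOn, restrict_offDiagonal_prod]
  exact (integrable_smul_convolution_integrand (L := ContinuousLinearMap.lsmul ℝ ℝ) hh hf
    (memLp_truncatedGreenKernel _) (measurable_truncatedGreenKernel _).stronglyMeasurable).congr
      (ae_mul_truncatedGreenKernel_eq hfR hhR)

theorem mutualEnergy_densityMeasure (hh : Integrable h ν)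
    (hhR : ∀ᵐ x ∂ν, x ∉ Metric.closedBall 0 R → h x = 0) (hf : MemLp f 2)
    (hfR : EssSupportSubset f (Metric.closedBall 0 R)) :
    mutualEnergy (ν.withDensityᵥ h) (densityMeasure f) =
      ∫ x, h x * (f ⋆ truncatedGreenKernel (2 * R)) x ∂ν := by
  rw [densityMeasure, mutualEnergy_withDensityᵥ hh (hfR.integrable hf)
    (hasFiniteMutualEnergy_densityMeasure hh hhR hf hfR), restrict_offDiagonal_prod,
    ← integral_congr_ae (ae_mul_truncatedGreenKernel_eq hfR hhR)]
  exact integral_prod_smul_convolution_integrand (L := ContinuousLinearMap.lsmul ℝ ℝ) hh hf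
    (memLp_truncatedGreenKernel _) (measurable_truncatedGreenKernel _).stronglyMeasurable

end Potential

section Limits

theorem tendsto_integral_mul_of_tendstoUniformly {ι X : Type*} [MeasurableSpace X] {l : Filter ι}
    {ν : ι → Measure X} {h u : ι → X → ℝ} {v : X → ℝ} {a : ℝ}
    (hh : ∀ i, Integrable (h i) (ν i)) (hhu : ∀ i, Integrable (fun x => h i x * u i x) (ν i))
    (hhv : ∀ i, Integrable (fun x => h i x * v x) (ν i))
    (hbdd : IsBoundedUnder (· ≤ ·) l fun i => ∫ x, ‖h i x‖ ∂(ν i)) (huv : TendstoUniformly u v l)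
    (hlim : Tendsto (fun i => ∫ x, h i x * v x ∂(ν i)) l (𝓝 a)) :
    Tendsto (fun i => ∫ x, h i x * u i x ∂(ν i)) l (𝓝 a) := by
  obtain ⟨C, hC⟩ := hbdd.eventually_le
  refine hlim.congr_dist (Metric.tendsto_nhds.2 fun ε hε => ?_)
  have hδ : 0 < ε / (|C| + 1) := by positivity
  filter_upwards [hC, Metric.tendstoUniformly_iff.1 huv _ hδ] with i hCi hi
  rw [Real.dist_0_eq_abs, abs_of_nonneg dist_nonneg, dist_eq_norm,
    ← integral_sub (hhv i) (hhu i)]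
  calc ‖∫ x, (h i x * v x - h i x * u i x) ∂(ν i)‖
      ≤ ∫ x, ‖h i x‖ * (ε / (|C| + 1)) ∂(ν i) := by
        refine norm_integral_le_of_norm_le ((hh i).norm.mul_const _)
          (Eventually.of_forall fun x => ?_)
        rw [← mul_sub, norm_mul, ← dist_eq_norm]
        gcongr
        exact (hi x).le
    _ = (∫ x, ‖h i x‖ ∂(ν i)) * (ε / (|C| + 1)) := integral_mul_const _ _
    _ < (|C| + 1) * (ε / (|C| + 1)) := by
        gcongr
        exact (hCi.trans (le_abs_self C)).trans_lt (lt_add_one _)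
    _ = ε := mul_div_cancel₀ _ (by positivity)

theorem tendsto_integral_norm_of_tendsto_eLpNorm_one {ι X E : Type*} [MeasurableSpace X]
    [NormedAddCommGroup E] {μ : Measure X} {l : Filter ι} {f : ι → X → E} {g : X → E}
    (hf : ∀ i, Integrable (f i) μ) (hg : Integrable g μ)
    (hlim : Tendsto (fun i => eLpNorm (f i - g) 1 μ) l (𝓝 0)) :
    Tendsto (fun i => ∫ x, ‖f i x‖ ∂μ) l (𝓝 (∫ x, ‖g x‖ ∂μ)) := by
  refine tendsto_integral_of_L1' _ hg.norm.1 (Eventually.of_forall fun i => (hf i).norm) ?_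
  refine tendsto_of_tendsto_of_tendsto_of_le_of_le tendsto_const_nhds hlim (fun _ => zero_le)
    fun i => eLpNorm_mono fun x => ?_
  exact abs_norm_sub_norm_le _ _

theorem weakStarTendsto_withDensityᵥ_iff {ν : ℕ → Measure Plane} {μ : Measure Plane}
    {h : ℕ → Plane → ℝ} {ρ : Plane → ℝ} (hh : ∀ N, Integrable (h N) (ν N))
    (hρ : Integrable ρ μ) :
    WeakStarTendsto (fun N => (ν N).withDensityᵥ (h N)) (μ.withDensityᵥ ρ) ↔
      ∀ φ : C₀(Plane, ℝ),
        Tendsto (fun N => ∫ x, h N x * φ x ∂(ν N)) atTop (𝓝 (∫ x, ρ x * φ x ∂μ)) := by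
  have hintegral {κ : Measure Plane} {w : Plane → ℝ} (hw : Integrable w κ) (φ : C₀(Plane, ℝ)) :
      (κ.withDensityᵥ w).integral (fun x => φ x) (ContinuousLinearMap.lsmul ℝ ℝ) =
        ∫ x, w x * φ x ∂κ := by
    rw [← lsmul_flip_real]
    exact integral_withDensityᵥ hw <| hw.mul_bdd φ.continuous.aestronglyMeasurable
      (Eventually.of_forall φ.toBCF.norm_coe_le_norm)
  simp only [WeakStarTendsto, hintegral hρ, hintegral (hh _)]

theorem weakStarTendsto_densityMeasure {f : ℕ → Plane → ℝ} {ρ : Plane → ℝ}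
    (hf : ∀ N, Integrable (f N)) (hρ : Integrable ρ)
    (hlim : Tendsto (fun N => eLpNorm (f N - ρ) 1) atTop (𝓝 0)) :
    WeakStarTendsto (fun N => densityMeasure (f N)) (densityMeasure ρ) := by
  refine (weakStarTendsto_withDensityᵥ_iff hf hρ).2 fun φ => ?_
  have hφ (x : Plane) : ‖φ x‖ ≤ ‖φ.toBCF‖ := φ.toBCF.norm_coe_le_norm x
  have hint {u : Plane → ℝ} (hu : Integrable u) : Integrable fun x => u x * φ x :=
    hu.mul_bdd φ.continuous.aestronglyMeasurable (Eventually.of_forall hφ)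
  have hbound : Tendsto (fun N => ENNReal.ofReal ‖φ.toBCF‖ * eLpNorm (f N - ρ) 1) atTop (𝓝 0) := by
    simpa only [mul_zero] using ENNReal.Tendsto.const_mul hlim (Or.inr ENNReal.ofReal_ne_top)
  refine tendsto_integral_of_L1' _ (hint hρ).1 (Eventually.of_forall fun N => hint (hf N)) ?_
  refine tendsto_of_tendsto_of_tendsto_of_le_of_le tendsto_const_nhds hbound (fun _ => zero_le)
    fun N => eLpNorm_le_mul_eLpNorm_of_ae_le_mul (Eventually.of_forall fun x => ?_) 1
  rw [Pi.sub_apply, ← sub_mul, mul_comm, norm_mul]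
  exact mul_le_mul_of_nonneg_right (hφ x) (norm_nonneg _)

variable {R : ℝ} {ν : ℕ → Measure Plane} {h f : ℕ → Plane → ℝ} {ρ : Plane → ℝ}

theorem WeakStarTendsto.tendsto_integral_mul
    (hlim : WeakStarTendsto (fun N => (ν N).withDensityᵥ (h N)) (densityMeasure ρ))
    (hh : ∀ N, Integrable (h N) (ν N))
    (hhR : ∀ N, ∀ᵐ x ∂(ν N), x ∉ Metric.closedBall 0 R → h N x = 0)
    (hρ : Integrable ρ) (hρR : EssSupportSubset ρ (Metric.closedBall 0 R))
    {u : Plane → ℝ} (hu : Continuous u) :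
    Tendsto (fun N => ∫ x, h N x * u x ∂(ν N)) atTop (𝓝 (∫ x, ρ x * u x)) := by
  obtain ⟨χ, hχ_one, -, hχ_supp, -⟩ := exists_continuous_one_zero_of_isCompact
    (isCompact_closedBall (0 : Plane) R) isClosed_empty (Set.disjoint_empty _)
  let φ : C₀(Plane, ℝ) :=
    ⟨⟨fun x => χ x * u x, χ.continuous.mul hu⟩, hχ_supp.mul_right.is_zero_at_infty⟩
  have hintegral {μ : Measure Plane} {w : Plane → ℝ}
      (hwR : ∀ᵐ x ∂μ, x ∉ Metric.closedBall 0 R → w x = 0) :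
      ∫ x, w x * φ x ∂μ = ∫ x, w x * u x ∂μ := by
    refine integral_congr_ae ?_
    filter_upwards [hwR] with x hx
    by_cases hxR : x ∈ Metric.closedBall 0 R
    · change w x * (χ x * u x) = w x * u x
      rw [hχ_one hxR, Pi.one_apply, one_mul]
    · simp only [hx hxR, zero_mul]
  simpa only [hintegral hρR, hintegral (hhR _)] using
    (weakStarTendsto_withDensityᵥ_iff hh hρ).1 hlim φ

theorem tendsto_mutualEnergy [∀ N, SFinite (ν N)]
    (hh : ∀ N, Integrable (h N) (ν N))
    (hhR : ∀ N, ∀ᵐ x ∂(ν N), x ∉ Metric.closedBall 0 R → h N x = 0)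
    (hbdd : IsBoundedUnder (· ≤ ·) atTop fun N => ∫ x, ‖h N x‖ ∂(ν N))
    (hh_lim : WeakStarTendsto (fun N => (ν N).withDensityᵥ (h N)) (densityMeasure ρ))
    (hf : ∀ N, MemLp (f N) 2) (hfR : ∀ N, EssSupportSubset (f N) (Metric.closedBall 0 R))
    (hρ : MemLp ρ 2) (hρR : EssSupportSubset ρ (Metric.closedBall 0 R))
    (hf_lim : Tendsto (fun N => eLpNorm (f N - ρ) 2) atTop (𝓝 0)) :
    Tendsto (fun N => mutualEnergy ((ν N).withDensityᵥ (h N)) (densityMeasure (f N))) atTop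
      (𝓝 (coulombEnergy (densityMeasure ρ))) := by
  have hG := memLp_truncatedGreenKernel (2 * R)
  have hcont {w : Plane → ℝ} (hw : MemLp w 2) : Continuous (w ⋆ truncatedGreenKernel (2 * R)) :=
    continuous_convolution_of_memLp (p := 2) ENNReal.ofNat_ne_top hw hG
  have hint {w : Plane → ℝ} (hw : MemLp w 2) (N : ℕ) :
      Integrable (fun x => h N x * (w ⋆ truncatedGreenKernel (2 * R)) x) (ν N) :=
    (hh N).mul_bdd (hcont hw).aestronglyMeasurable
      (Eventually.of_forall (norm_convolution_le hw hG))
  have hself : coulombEnergy (densityMeasure ρ) =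
      ∫ x, ρ x * (ρ ⋆ truncatedGreenKernel (2 * R)) x :=
    mutualEnergy_densityMeasure (hρR.integrable hρ) hρR hρ hρR
  simp only [hself, mutualEnergy_densityMeasure (hh _) (hhR _) (hf _) (hfR _)]
  exact tendsto_integral_mul_of_tendstoUniformly hh (fun N => hint (hf N) N) (hint hρ) hbdd
    (tendstoUniformly_convolution hf hρ hG hf_lim)
    (hh_lim.tendsto_integral_mul hh hhR (hρR.integrable hρ) hρR (hcont hρ))

end Limits

section ModulatedEnergy

theorem densityMeasure_add_sub {f g h : Plane → ℝ} (hf : Integrable f) (hg : Integrable g)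
    (hh : Integrable h) :
    densityMeasure (f + g - h) = densityMeasure f + densityMeasure g - densityMeasure h := by
  simp only [densityMeasure, withDensityᵥ_sub (hf.add hg) hh, withDensityᵥ_add hf hg]

variable {R : ℝ} {ρ : Plane → ℝ}

theorem hasFiniteCoulombEnergy_densityMeasure (hρ : MemLp ρ 2)
    (hρR : EssSupportSubset ρ (Metric.closedBall 0 R)) :
    HasFiniteCoulombEnergy (densityMeasure ρ) :=
  hasFiniteMutualEnergy_densityMeasure (hρR.integrable hρ) hρR hρ hρR

theorem coulombEnergy_densityMeasure (hρ : MemLp ρ 2)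
    (hρR : EssSupportSubset ρ (Metric.closedBall 0 R)) :
    coulombEnergy (densityMeasure ρ) =
      ∫ p : Plane × Plane, greenKernel (p.1 - p.2) * ρ p.1 * ρ p.2 := by
  have hint := hρR.integrable hρ
  calc coulombEnergy (densityMeasure ρ)
      = ∫ p in offDiagonal, ρ p.1 * ρ p.2 * greenKernel (p.1 - p.2)
          ∂((volume : Measure Plane).prod volume) :=
        mutualEnergy_withDensityᵥ hint hint (hasFiniteCoulombEnergy_densityMeasure hρ hρR)
    _ = ∫ p : Plane × Plane, greenKernel (p.1 - p.2) * ρ p.1 * ρ p.2 := by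
        rw [restrict_offDiagonal_prod]
        exact integral_congr_ae (Eventually.of_forall fun p => by ring)

theorem hasFiniteMutualEnergy_empiricalMeasure_densityMeasure {N : ℕ} {q : Fin N → Plane}
    (hqR : ∀ i, q i ∈ Metric.closedBall 0 R) (hρ : MemLp ρ 2)
    (hρR : EssSupportSubset ρ (Metric.closedBall 0 R)) :
    HasFiniteMutualEnergy (empiricalMeasure q) (densityMeasure ρ) := by
  rw [empiricalMeasure_eq_withDensityᵥ]
  exact hasFiniteMutualEnergy_densityMeasure (integrable_empiricalPosMeasure q 1)
    (ae_empiricalPosMeasure fun i hi => absurd (hqR i) hi) hρ hρR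

variable {f : ℕ → Plane → ℝ} {q : (N : ℕ) → Fin N → Plane}

theorem tendsto_coulombEnergy_densityMeasure (hf : ∀ N, MemLp (f N) 2)
    (hfR : ∀ N, EssSupportSubset (f N) (Metric.closedBall 0 R)) (hρ : MemLp ρ 2)
    (hρR : EssSupportSubset ρ (Metric.closedBall 0 R))
    (hlim : Tendsto (fun N => eLpNorm (f N - ρ) 2) atTop (𝓝 0)) :
    Tendsto (fun N => coulombEnergy (densityMeasure (f N))) atTop
      (𝓝 (coulombEnergy (densityMeasure ρ))) := by
  have hint (N : ℕ) := (hfR N).integrable (hf N)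
  have hlim_one : Tendsto (fun N => eLpNorm (f N - ρ) 1) atTop (𝓝 0) := by
    have hbound := ENNReal.Tendsto.mul_const hlim (Or.inr (ENNReal.rpow_ne_top_of_nonneg
      (by norm_num : 0 ≤ 1 - 1 / (2 : ℝ≥0∞).toReal)
      (measure_closedBall_lt_top (μ := (volume : Measure Plane)) (x := 0) (r := R)).ne))
    rw [zero_mul] at hbound
    exact tendsto_of_tendsto_of_tendsto_of_le_of_le tendsto_const_nhds hbound (fun _ => zero_le)
      fun N => eLpNorm_one_le_of_ae_eq_zero_off one_le_two ((hf N).sub hρ).1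
        measurableSet_closedBall ((hfR N).sub hρR)
  exact tendsto_mutualEnergy hint hfR
    (tendsto_integral_norm_of_tendsto_eLpNorm_one hint (hρR.integrable hρ)
      hlim_one).isBoundedUnder_le
    (weakStarTendsto_densityMeasure hint (hρR.integrable hρ) hlim_one) hf hfR hρ hρR hlim

theorem tendsto_mutualEnergy_empiricalMeasure (hf : ∀ N, MemLp (f N) 2)
    (hfR : ∀ N, EssSupportSubset (f N) (Metric.closedBall 0 R)) (hρ : MemLp ρ 2)
    (hρR : EssSupportSubset ρ (Metric.closedBall 0 R))
    (hlim : Tendsto (fun N => eLpNorm (f N - ρ) 2) atTop (𝓝 0))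
    (hqR : ∀ N i, q N i ∈ Metric.closedBall 0 R)
    (hq_lim : WeakStarTendsto (fun N => empiricalMeasure (q N)) (densityMeasure ρ)) :
    Tendsto (fun N => mutualEnergy (empiricalMeasure (q N)) (densityMeasure (f N))) atTop
      (𝓝 (coulombEnergy (densityMeasure ρ))) := by
  have hmass (N : ℕ) : ∫ x, ‖(1 : Plane → ℝ) x‖ ∂(empiricalPosMeasure (q N)) ≤ 1 := by
    rw [integral_empiricalPosMeasure]
    simpa using inv_mul_le_one
  simp only [empiricalMeasure_eq_withDensityᵥ] at hq_lim ⊢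
  exact tendsto_mutualEnergy (fun N => integrable_empiricalPosMeasure (q N) 1)
    (fun N => ae_empiricalPosMeasure fun i hi => absurd (hqR N i) hi)
    (isBoundedUnder_of ⟨1, hmass⟩) hq_lim hf hfR hρ hρR hlim

theorem tendsto_coulombEnergy_densityMeasure_sub_empiricalMeasure (hf : ∀ N, MemLp (f N) 2)
    (hfR : ∀ N, EssSupportSubset (f N) (Metric.closedBall 0 R)) (hρ : MemLp ρ 2)
    (hρR : EssSupportSubset ρ (Metric.closedBall 0 R))
    (hlim : Tendsto (fun N => eLpNorm (f N - ρ) 2) atTop (𝓝 0))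
    (hqR : ∀ N i, q N i ∈ Metric.closedBall 0 R)
    (hq_lim : WeakStarTendsto (fun N => empiricalMeasure (q N)) (densityMeasure ρ))
    (henergy_lim : Tendsto (fun N => coulombEnergy (empiricalMeasure (q N))) atTop
      (𝓝 (coulombEnergy (densityMeasure ρ)))) :
    Tendsto (fun N => coulombEnergy (densityMeasure (f N) - empiricalMeasure (q N))) atTop
      (𝓝 0) := by
  have hexpand (N : ℕ) : coulombEnergy (densityMeasure (f N) - empiricalMeasure (q N)) =
      coulombEnergy (densityMeasure (f N))
        - 2 * mutualEnergy (empiricalMeasure (q N)) (densityMeasure (f N))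
        + coulombEnergy (empiricalMeasure (q N)) := by
    rw [coulombEnergy_sub (hasFiniteCoulombEnergy_densityMeasure (hf N) (hfR N))
      (hasFiniteMutualEnergy_empiricalMeasure_densityMeasure (hqR N) (hf N) (hfR N)).symm
      (hasFiniteCoulombEnergy_empiricalMeasure (q N)), mutualEnergy_comm]
  have hself_lim := tendsto_coulombEnergy_densityMeasure hf hfR hρ hρR hlim
  have hcross_lim := tendsto_mutualEnergy_empiricalMeasure hf hfR hρ hρR hlim hqR hq_lim
  have hsum_lim := (hself_lim.sub (hcross_lim.const_mul 2)).add henergy_lim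
  simp only [hexpand]
  convert hsum_lim using 2
  ring

end ModulatedEnergy

theorem proposition1p7
    (ω₀ ρ₀ : Plane → ℝ) (ω : ℕ → Plane → ℝ) (q : (N : ℕ) → Fin N → Plane) (K : Set Plane)
    (hω₀ : MemLp ω₀ 2 volume) (hω₀_supp : HasCompactEssSupport ω₀)
    (hρ₀ : MemLp ρ₀ 2 volume) (hρ₀_supp : HasCompactEssSupport ρ₀)
    (hω : ∀ N, MemLp (ω N) 2 volume)
    (hq : ∀ N, Function.Injective (q N))
    (hK : IsCompact K)
    (hω_supp : ∀ N, EssSupportSubset (ω N) K)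
    (hq_supp : ∀ N i, q N i ∈ K)
    (hω_lim : Tendsto (fun N => eLpNorm (ω N - ω₀) 2 volume) atTop (𝓝 0))
    (hρ_lim : WeakStarTendsto (fun N => empiricalMeasure (q N)) (densityMeasure ρ₀))
    (henergy_lim : Tendsto
      (fun N : ℕ => 1 / (N : ℝ) ^ 2 *
        ∑ p ∈ (Finset.univ : Finset (Fin N)).offDiag, greenKernel (q N p.1 - q N p.2))
      atTop
      (𝓝 (∫ p : Plane × Plane, greenKernel (p.1 - p.2) * ρ₀ p.1 * ρ₀ p.2))) :
    (∀ N, HasFiniteCoulombEnergy (densityMeasure ρ₀ + densityMeasure ω₀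
        - empiricalMeasure (q N) - densityMeasure (ω N))) ∧
    Tendsto (fun N => coulombEnergy (densityMeasure ρ₀ + densityMeasure ω₀
        - empiricalMeasure (q N) - densityMeasure (ω N))) atTop (𝓝 0) := by
  obtain ⟨K₁, hK₁, hω₀K⟩ := hω₀_supp
  obtain ⟨K₂, hK₂, hρ₀K⟩ := hρ₀_supp
  obtain ⟨R, hR⟩ := ((hK.union hK₁).union hK₂).isBounded.subset_closedBall (0 : Plane)
  simp only [Set.union_subset_iff] at hR
  obtain ⟨⟨hKR, hK₁R⟩, hK₂R⟩ := hR
  have hω₀R := hω₀K.mono hK₁R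
  have hρ₀R := hρ₀K.mono hK₂R
  have hωR (N : ℕ) := (hω_supp N).mono hKR
  have hqR (N : ℕ) (i : Fin N) := hKR (hq_supp N i)
  have hf (N : ℕ) : MemLp (ρ₀ + ω₀ - ω N) 2 := (hρ₀.add hω₀).sub (hω N)
  have hfR (N : ℕ) := (hρ₀R.add hω₀R).sub (hωR N)
  have hf_lim : Tendsto (fun N => eLpNorm (ρ₀ + ω₀ - ω N - ρ₀) 2) atTop (𝓝 0) := by
    simpa only [add_sub_assoc ρ₀ ω₀, add_sub_cancel_left, eLpNorm_sub_comm ω₀] using hω_lim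
  have hσ (N : ℕ) : densityMeasure ρ₀ + densityMeasure ω₀ - empiricalMeasure (q N)
      - densityMeasure (ω N) = densityMeasure (ρ₀ + ω₀ - ω N) - empiricalMeasure (q N) := by
    rw [densityMeasure_add_sub (hρ₀R.integrable hρ₀) (hω₀R.integrable hω₀)
      ((hωR N).integrable (hω N)), sub_right_comm]
  simp only [← coulombEnergy_empiricalMeasure (hq _), ← coulombEnergy_densityMeasure hρ₀ hρ₀R]
    at henergy_lim
  simp only [hσ]
  exact ⟨fun N => (hasFiniteCoulombEnergy_densityMeasure (hf N) (hfR N)).sub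
      (hasFiniteMutualEnergy_empiricalMeasure_densityMeasure (hqR N) (hf N) (hfR N)).symm
      (hasFiniteCoulombEnergy_empiricalMeasure (q N)),
    tendsto_coulombEnergy_densityMeasure_sub_empiricalMeasure hf hfR hρ₀ hρ₀R hf_lim hqR hρ_lim
      henergy_lim⟩
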